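/- Let $G$ be a finite simple graph with $2n$ vertices, not necessarily bipartite, drawn in the plane without crossings, whose edges carry weights in a commutative semiring (for example real numbers or indeterminates). For a weighted graph $H$ let $M(H)$ be the sum, over all perfect matchings of $H$, of the product of the weights of the edges in the matching; for a set $S$ of vertices let $G-S$ be the weighted graph obtained from $G$ by deleting the vertices in $S$ and all edges incident with them. Let $2\le k\le n$ and let $a_1,b_1,a_2,b_2,\dots,a_k,b_k$ be distinct vertices that appear in this cyclic order on a face $F$ of $G$; that is, there is a closed topological disc that is contained in $F$ except that its boundary curve passes through precisely these $2k$ vertices, in this cyclic order. Put $A=\{a_1,\dots,a_k\}$ and $B=\{b_1,\dots,b_k\}$. Then for every $j\in\{1,\dots,k\}$, $$\sum_{\substack{Y\subseteq B\\ |Y|\text{ odd}}} M\bigl(G-(\{a_j\}\cup Y)\bigr)\,M\bigl(G-((A\setminus\{a_j\})\cup(B\setminus Y))\bigr)=\sum_{\substack{W\subseteq B\\ |W|\text{ even}}} M(G-W)\,M\bigl(G-(A\cup(B\setminus W))\bigr).$$ In particular, if $k=2$, then $$M(G)\,M(G-\{a_1,b_1,a_2,b_2\})+M(G-\{a_1,a_2\})\,M(G-\{b_1,b_2\})=M(G-\{a_1,b_1\})\,M(G-\{a_2,b_2\})+M(G-\{a_1,b_2\})\,M(G-\{b_1,a_2\}).$$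 -/

import Mathlib

namespace PlaneCondensation

/-- `S` is a simple arc in the plane (identified with `ℂ`) with end points `p` and `q`. -/
def IsArc (S : Set ℂ) (p q : ℂ) : Prop :=
  ∃ γ : C(unitInterval, ℂ), Function.Injective γ ∧ γ 0 = p ∧ γ 1 = q ∧ Set.range γ = S

/-- A drawing of the simple graph `G` in the plane without crossings: distinct vertices are distinct
points, an edge `uv` is a simple arc joining `u` and `v`, an edge contains no vertices but its two
ends, and two different edges meet at most in vertices. -/
structure PlaneDrawing {V : Type*} (G : SimpleGraph V) where
  pos : V → ℂ
  pos_injective : Function.Injective pos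
  arc : G.edgeSet → Set ℂ
  isArc : ∀ (u v : V) (h : G.Adj u v), IsArc (arc ⟨s(u, v), h⟩) (pos u) (pos v)
  mem_of_pos_mem_arc : ∀ (e : G.edgeSet) (v : V), pos v ∈ arc e → v ∈ (e : Sym2 V)
  arc_inter_subset : ∀ e e' : G.edgeSet, e ≠ e' → arc e ∩ arc e' ⊆ Set.range pos

namespace PlaneDrawing

variable {V : Type*} {G : SimpleGraph V}

/-- The set of points of the plane covered by the vertices and edges of the drawing. -/
def support (D : PlaneDrawing G) : Set ℂ :=
  Set.range D.pos ∪ ⋃ e, D.arc e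

/-- The faces of a plane graph are the connected components of the complement of the drawing
(the unbounded one included). -/
def IsFace (D : PlaneDrawing G) (F : Set ℂ) : Prop :=
  ∃ z ∈ D.supportᶜ, F = connectedComponentIn D.supportᶜ z

/-- The vertices `x 0, x 1, …, x (m - 1)` appear in this cyclic order on the face `F`: a closed
topological disc (the image of the closed unit disc under an injective continuous map `f`) lies in
`F` except that its boundary curve runs through these vertices, one after the other in the given
order, during one turn. The vertices are thus distinct points on the boundary of `F`.
Both orientations are allowed, as `f` may be preceded by a reflection, and a vertex that
the boundary of `F` visits several times may be taken at any one of these visits. -/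
def CyclicOnFace (D : PlaneDrawing G) (F : Set ℂ) {m : ℕ} (x : Fin m → V) : Prop :=
  ∃ (f : ℂ → ℂ) (θ : Fin m → ℝ),
    ContinuousOn f (Metric.closedBall 0 1) ∧
    Set.InjOn f (Metric.closedBall 0 1) ∧
    StrictMono θ ∧
    (∀ i, θ i ∈ Set.Ico 0 (2 * Real.pi)) ∧
    (∀ i, f (Complex.exp (θ i * Complex.I)) = D.pos (x i)) ∧
    ∀ z ∈ Metric.closedBall (0 : ℂ) 1, (∀ i, z ≠ Complex.exp (θ i * Complex.I)) → f z ∈ F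

end PlaneDrawing

/-- The sequence `a 0, b 0, a 1, b 1, …, a (k - 1), b (k - 1)`. -/
def interleave {V : Type*} {k : ℕ} (a b : Fin k → V) (m : Fin (2 * k)) : V :=
  if (m : ℕ) % 2 = 0 then a ⟨(m : ℕ) / 2, by omega⟩ else b ⟨(m : ℕ) / 2, by omega⟩

open Classical in
/-- The sum of the weights of the perfect matchings of `G` with edge weights `w`, the weight of a
perfect matching being the product of the weights of its edges. (Only the values of `w` on the
edges of `G` matter.) -/
noncomputable def matchingSum {V R : Type*} [Fintype V] [CommSemiring R]
    (G : SimpleGraph V) (w : Sym2 V → R) : R :=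
  ∑ P : {P : G.Subgraph // P.IsPerfectMatching}, ∏ e ∈ P.1.edgeSet.toFinset, w e

open Classical in
/-- `M(G - S)`: the matching sum of the weighted graph obtained from `G` by deleting the vertices
in `S` and all edges incident with them. -/
noncomputable def matchingSumDelete {V R : Type*} [Fintype V] [CommSemiring R]
    (G : SimpleGraph V) (w : Sym2 V → R) (S : Finset V) : R :=
  matchingSum (G.induce {v | v ∉ S}) (fun e => w (e.map Subtype.val))

end PlaneCondensation

/-! Superimpose the two matchings counted by a product. In every product each vertex of A ∪ B is
deleted from exactly one of the two graphs, so these vertices are the ends of the paths in the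
union. By planarity the paths pair them up without crossings; paired vertices then sit at positions
of different parity on the face, so the path from `a j` ends at some `b i`
(`odd_sub_of_noncrossing`, `component_inter`). Exchanging the matchings along this path moves `a j`
and `b i` to the other deleted sets, flips the parity of the subset of B, keeps the product of the
weights, and is undone by repetition. This bijection of terms is `condensation`; nothing is
subtracted, so a semiring suffices.

The topological input is `not_exists_disjoint_paths`, proved with winding numbers instead of the
Jordan curve theorem. If two crossing chords of the disc were closed up by disjoint paths outside,
the difference of the two curves would have winding zero along the boundary of the parameter square
of the chords. Inside the disc it deforms to an odd map, whose winding is not zero. -/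

namespace PlaneCondensation

/-! ### Winding numbers and crossing chords of a disc. -/

section Crossing

open unitInterval

/-- The increment of a continuous logarithm along a path avoiding the origin. -/
noncomputable def logIncrement (γ : I → ℂ) : ℂ :=
  open Classical in
  if h : ∃ L : I → ℂ, Continuous L ∧ ∀ t, Complex.exp (L t) = γ t
  then h.choose 1 - h.choose 0 else 0

theorem exists_continuous_log {X : Type*} [TopologicalSpace X] [SimplyConnectedSpace X]
    [LocallyPathConnectedSpace X] (g : X → ℂ) (hg : Continuous g) (h0 : ∀ x, g x ≠ 0) :
    ∃ L : X → ℂ, Continuous L ∧ ∀ x, Complex.exp (L x) = g x := by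
  obtain ⟨x₀⟩ : Nonempty X := inferInstance
  obtain ⟨L, ⟨-, hL⟩, -⟩ := Complex.isCoveringMapOn_exp.existsUnique_continuousMap_lifts
    ⟨g, hg⟩ (a₀ := x₀) (Complex.exp_log (h0 x₀)) (fun x => h0 x)
  exact ⟨L, L.continuous, fun x => congrFun hL x⟩

instance : ContractibleSpace I := (convex_Icc (0 : ℝ) 1).contractibleSpace ⟨0, by simp⟩

instance : LocallyPathConnectedSpace I :=
  (isQuotientMap_projIcc (h := zero_le_one' ℝ)).locallyPathConnectedSpace

theorem logIncrement_eq {γ L : I → ℂ} (hL : Continuous L) (h : ∀ t, Complex.exp (L t) = γ t) :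
    logIncrement γ = L 1 - L 0 := by
  have hex : ∃ L : I → ℂ, Continuous L ∧ ∀ t, Complex.exp (L t) = γ t := ⟨L, hL, h⟩
  rw [logIncrement, dif_pos hex]
  obtain ⟨hc, hs⟩ := hex.choose_spec
  set M := hex.choose
  have hγ : Continuous γ := by
    rw [← funext h]; exact Complex.continuous_exp.comp hL
  have hu := Complex.isCoveringMapOn_exp.existsUnique_continuousMap_lifts
    ⟨γ, hγ⟩ (a₀ := 0) (h 0) (fun x => by simp [← h])
  have h0 : Complex.exp (L 0 - M 0) = 1 := by
    rw [Complex.exp_sub, h, hs, div_self]; rw [← h]; exact Complex.exp_ne_zero _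
  have := hu.unique (y₁ := ⟨L, hL⟩) (y₂ := ⟨fun t => M t + (L 0 - M 0), by fun_prop⟩)
    ⟨rfl, funext h⟩ ⟨by simp, funext fun t => by simp [Complex.exp_add, h0, hs]⟩
  have h1 := DFunLike.congr_fun this 1
  simp only [ContinuousMap.coe_mk] at h1
  rw [h1]; ring

theorem logIncrement_symm {γ : I → ℂ} (hγ : Continuous γ) (h : ∀ t, γ t ≠ 0) :
    logIncrement (fun t => -γ (σ t)) = -logIncrement γ := by
  obtain ⟨L, hL, hs⟩ := exists_continuous_log γ hγ h
  rw [logIncrement_eq hL hs, logIncrement_eq (L := fun t => L (σ t) + Real.pi * Complex.I)]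
  · simp
  · fun_prop
  · intro t; simp [Complex.exp_add, hs]

theorem exp_logIncrement {γ : I → ℂ} (hγ : Continuous γ) (h : ∀ t, γ t ≠ 0) :
    Complex.exp (logIncrement γ) = γ 1 / γ 0 := by
  obtain ⟨L, hL, hs⟩ := exists_continuous_log γ hγ h
  rw [logIncrement_eq hL hs, Complex.exp_sub, hs, hs]

theorem logIncrement_rectangle {g : I × I → ℂ} (hg : Continuous g) (h : ∀ x, g x ≠ 0) :
    logIncrement (fun s => g (s, 0)) + logIncrement (fun t => g (1, t)) =
      logIncrement (fun t => g (0, t)) + logIncrement (fun s => g (s, 1)) := by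
  obtain ⟨L, hL, hs⟩ := exists_continuous_log g hg h
  rw [logIncrement_eq (L := fun s => L (s, 0)) (by fun_prop) (fun _ => hs _),
    logIncrement_eq (L := fun s => L (1, s)) (by fun_prop) (fun _ => hs _),
    logIncrement_eq (L := fun s => L (s, 1)) (by fun_prop) (fun _ => hs _),
    logIncrement_eq (L := fun s => L (0, s)) (by fun_prop) (fun _ => hs _)]
  ring

/-- A map of the square whose restriction to the boundary is odd and does not vanish has
nonzero logarithmic increment along the boundary. -/
theorem logIncrement_boundary_ne_of_odd {g : I × I → ℂ} (hg : Continuous g)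
    (h : ∀ x : I × I, (x.1 = 0 ∨ x.1 = 1 ∨ x.2 = 0 ∨ x.2 = 1) → g x ≠ 0)
    (hodd : ∀ s t, g (σ s, σ t) = -g (s, t)) :
    logIncrement (fun s => g (s, 0)) + logIncrement (fun t => g (1, t)) ≠
      logIncrement (fun t => g (0, t)) + logIncrement (fun s => g (s, 1)) := by
  have e1 : logIncrement (fun t => g (0, t)) = -logIncrement (fun t => g (1, t)) := by
    rw [← logIncrement_symm (by fun_prop) (fun t => h _ (by simp))]
    congr 1; ext t; rw [← hodd]; simp
  have e2 : logIncrement (fun s => g (s, 1)) = -logIncrement (fun t => g (t, 0)) := by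
    rw [← logIncrement_symm (by fun_prop) (fun t => h _ (by simp))]
    congr 1; ext t; rw [← hodd]; simp
  rw [e1, e2]
  intro hc
  -- By oddness opposite sides contribute equally, so half of the boundary has increment zero. But
  -- this half leads from `g (0, 0)` to `g (1, 1) = -g (0, 0)`, and the exponential of its increment
  -- is -1.
  have h0 : logIncrement (fun s => g (s, 0)) + logIncrement (fun t => g (1, t)) = 0 := by
    linear_combination hc / 2
  have h1 := congrArg Complex.exp h0
  rw [Complex.exp_add, exp_logIncrement (by fun_prop) (fun t => h _ (by simp)),
    exp_logIncrement (by fun_prop) (fun t => h _ (by simp)), Complex.exp_zero] at h1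
  have h10 : g (1, 0) ≠ 0 := h _ (by simp)
  have h00 : g (0, 0) ≠ 0 := h _ (by simp)
  have h11 : g (1, 1) = - g (0, 0) := by rw [← hodd]; simp
  rw [h11] at h1
  field_simp at h1
  norm_num at h1

/-- The logarithmic increment along the boundary of a square is a homotopy invariant. -/
theorem logIncrement_boundary_homotopy {g : I × I × I → ℂ} (hg : Continuous g)
    (h : ∀ l s t : I, (s = 0 ∨ s = 1 ∨ t = 0 ∨ t = 1) → g (l, s, t) ≠ 0) :
    logIncrement (fun s => g (0, s, 0)) + logIncrement (fun t => g (0, 1, t)) -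
      logIncrement (fun t => g (0, 0, t)) - logIncrement (fun s => g (0, s, 1)) =
    logIncrement (fun s => g (1, s, 0)) + logIncrement (fun t => g (1, 1, t)) -
      logIncrement (fun t => g (1, 0, t)) - logIncrement (fun s => g (1, s, 1)) := by
  -- These are the four lateral faces of the cube; the increments along the edges in direction `l`
  -- cancel.
  have r1 := logIncrement_rectangle (g := fun x : I × I => g (x.1, x.2, 0)) (by fun_prop)
    (fun x => h _ _ _ (by simp))
  have r2 := logIncrement_rectangle (g := fun x : I × I => g (x.1, 1, x.2)) (by fun_prop)
    (fun x => h _ _ _ (by simp))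
  have r3 := logIncrement_rectangle (g := fun x : I × I => g (x.1, 0, x.2)) (by fun_prop)
    (fun x => h _ _ _ (by simp))
  have r4 := logIncrement_rectangle (g := fun x : I × I => g (x.1, x.2, 1)) (by fun_prop)
    (fun x => h _ _ _ (by simp))
  simp only at r1 r2 r3 r4
  linear_combination -r1 - r2 + r3 + r4

/-- If `c`, `d` extend to closed curves by `p`, `q` such that `c × d` contains all pairs of
parameters of coinciding points, the increment of the difference along the boundary vanishes. -/
theorem logIncrement_boundary_of_closed_curves {c d p q : I → ℂ} (hc : Continuous c)
    (hd : Continuous d) (hp : Continuous p) (hq : Continuous q)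
    (hcp : c 1 = p 0) (hpc : p 1 = c 0) (hdq : d 1 = q 0) (hqd : q 1 = d 0)
    (h1 : ∀ s t, c s ≠ q t) (h2 : ∀ s t, p s ≠ d t) (h3 : ∀ s t, p s ≠ q t) :
    logIncrement (fun s => c s - d 0) + logIncrement (fun t => c 1 - d t) =
      logIncrement (fun t => c 0 - d t) + logIncrement (fun s => c s - d 1) := by
  -- The torus of parameter pairs consists of four squares. The difference vanishes nowhere on three
  -- of them, and the boundaries of all four cancel.
  have r1 := logIncrement_rectangle (g := fun x : I × I => c x.1 - q x.2) (by fun_prop)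
    (fun x => sub_ne_zero.2 (h1 _ _))
  have r2 := logIncrement_rectangle (g := fun x : I × I => p x.1 - d x.2) (by fun_prop)
    (fun x => sub_ne_zero.2 (h2 _ _))
  have r3 := logIncrement_rectangle (g := fun x : I × I => p x.1 - q x.2) (by fun_prop)
    (fun x => sub_ne_zero.2 (h3 _ _))
  simp only [hqd, hpc, ← hcp, ← hdq] at r1 r2 r3
  linear_combination -r1 - r2 - r3

/-- Twice the signed area of the triangle `a b c`. -/
noncomputable def orientation (a b c : ℂ) : ℝ :=
  (b.re - a.re) * (c.im - a.im) - (b.im - a.im) * (c.re - a.re)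

theorem orientation_exp (x y z : ℝ) :
    orientation (Complex.exp (x * Complex.I)) (Complex.exp (y * Complex.I))
      (Complex.exp (z * Complex.I)) =
    4 * Real.sin ((y - x) / 2) * Real.sin ((z - y) / 2) * Real.sin ((z - x) / 2) := by
  obtain ⟨u, rfl⟩ : ∃ u, x = y - 2 * u := ⟨(y - x) / 2, by ring⟩
  obtain ⟨v, rfl⟩ : ∃ v, z = y + 2 * v := ⟨(z - y) / 2, by ring⟩
  have h : orientation (Complex.exp ((y - 2 * u : ℝ) * Complex.I)) (Complex.exp (y * Complex.I))
      (Complex.exp ((y + 2 * v : ℝ) * Complex.I)) =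
      Real.sin (y - (y - 2 * u)) + Real.sin (y + 2 * v - y) -
        Real.sin (y + 2 * v - (y - 2 * u)) := by
    simp only [orientation, Complex.exp_ofReal_mul_I_re, Complex.exp_ofReal_mul_I_im]
    generalize y - 2 * u = x
    generalize y + 2 * v = z
    simp only [Real.sin_sub]
    ring
  rw [h, show y - (y - 2 * u) = 2 * u by ring, show y + 2 * v - y = 2 * v by ring,
    show y + 2 * v - (y - 2 * u) = 2 * u + 2 * v by ring,
    show 2 * u / 2 = u by ring, show 2 * v / 2 = v by ring,
    show (2 * u + 2 * v) / 2 = u + v by ring]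
  simp only [Real.sin_add, Real.sin_two_mul, Real.cos_two_mul']
  linear_combination -2 * Real.sin u * Real.cos u * Real.sin_sq_add_cos_sq v
    - 2 * Real.sin v * Real.cos v * Real.sin_sq_add_cos_sq u

theorem orientation_exp_pos {x y z : ℝ} (hxy : x < y) (hyz : y < z)
    (hzx : z < x + 2 * Real.pi) :
    0 < orientation (Complex.exp (x * Complex.I)) (Complex.exp (y * Complex.I))
      (Complex.exp (z * Complex.I)) := by
  rw [orientation_exp]
  have h1 := Real.sin_pos_of_pos_of_lt_pi (x := (y - x) / 2) (by linarith) (by linarith)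
  have h2 := Real.sin_pos_of_pos_of_lt_pi (x := (z - y) / 2) (by linarith) (by linarith)
  have h3 := Real.sin_pos_of_pos_of_lt_pi (x := (z - x) / 2) (by linarith) (by linarith)
  positivity

/-- If the end points of each of two chords of a disc lie on different sides of the other one, their
images under an injective map of the disc cannot be completed to disjoint closed curves outside. -/
theorem not_exists_disjoint_paths {f : ℂ → ℂ} (hf : ContinuousOn f (Metric.closedBall 0 1))
    (hinj : Set.InjOn f (Metric.closedBall 0 1)) {z₁ z₂ z₃ z₄ : ℂ}
    (n1 : ‖z₁‖ = 1) (n2 : ‖z₂‖ = 1) (n3 : ‖z₃‖ = 1) (n4 : ‖z₄‖ = 1)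
    (o123 : 0 < orientation z₁ z₂ z₃) (o124 : 0 < orientation z₁ z₂ z₄)
    (o134 : 0 < orientation z₁ z₃ z₄) (o234 : 0 < orientation z₂ z₃ z₄)
    {S₁ S₂ : Set ℂ} (hS : Disjoint S₁ S₂) (j1 : JoinedIn S₁ (f z₁) (f z₃))
    (j2 : JoinedIn S₂ (f z₂) (f z₄))
    (hball : ∀ z ∈ Metric.closedBall (0 : ℂ) 1, f z ∈ S₁ ∪ S₂ → ‖z‖ = 1) : False := by
  have hseg : ∀ {x y : ℂ}, ‖x‖ = 1 → ‖y‖ = 1 → ∀ t : I,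
      AffineMap.lineMap x y (t : ℝ) ∈ Metric.closedBall (0 : ℂ) 1 := by
    intro x y hx hy t
    exact (convex_closedBall (0 : ℂ) 1).lineMap_mem (by simp [hx]) (by simp [hy]) t.2
  have hend : ∀ {x y : ℂ}, ‖x‖ = 1 → ‖y‖ = 1 → x ≠ y → ∀ t : I,
      ‖(AffineMap.lineMap x y (t : ℝ) : ℂ)‖ = 1 → t = 0 ∨ t = 1 := by
    intro x y hx hy hxy t ht
    by_contra hcon
    push Not at hcon
    have hto : (t : ℝ) ∈ Set.Ioo (0 : ℝ) 1 :=
      ⟨unitInterval.pos_iff_ne_zero.2 hcon.1, unitInterval.lt_one_iff_ne_one.2 hcon.2⟩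
    have := (strictConvex_closedBall ℝ (0 : ℂ) 1) (by simp [hx]) (by simp [hy]) hxy
      (a := 1 - t) (b := t) (by linarith [hto.2]) hto.1 (by ring)
    rw [interior_closedBall _ one_ne_zero, mem_ball_zero_iff] at this
    rw [AffineMap.lineMap_apply_module] at ht
    linarith
  have h13 : z₁ ≠ z₃ := by rintro rfl; simp [orientation] at o123
  have h24 : z₂ ≠ z₄ := by rintro rfl; simp [orientation, mul_comm] at o124
  have m : ∀ {z : ℂ}, ‖z‖ = 1 → z ∈ Metric.closedBall (0 : ℂ) 1 := fun h => by simp [h]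
  obtain ⟨α, hα⟩ := j1.symm
  obtain ⟨β, hβ⟩ := j2.symm
  set c : I → ℂ := fun s => AffineMap.lineMap z₁ z₃ (s : ℝ) with hc
  set d : I → ℂ := fun s => AffineMap.lineMap z₂ z₄ (s : ℝ) with hd
  have hcc : Continuous c := by fun_prop
  have hdc : Continuous d := by fun_prop
  have hcm : ∀ s, c s ∈ Metric.closedBall (0 : ℂ) 1 := hseg n1 n3
  have hdm : ∀ s, d s ∈ Metric.closedBall (0 : ℂ) 1 := hseg n2 n4
  have hS1 := j1.mem
  have hS2 := j2.mem
  -- the increment along the boundary vanishes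
  have hzero := logIncrement_boundary_of_closed_curves (c := fun s => f (c s))
    (d := fun s => f (d s)) (hf.comp_continuous hcc hcm) (hf.comp_continuous hdc hdm)
    α.continuous β.continuous (by simp [c]) (by simp [c]) (by simp [d]) (by simp [d])
    -- Inner points of a chord have norm less than 1, so `hball` keeps their images out of both
    -- sets; the end points are handled by disjointness.
    (fun s t h => by
      have h1 := hball _ (hcm s) (Or.inr (h ▸ hβ t))
      have h2 : f (c s) ∈ S₂ := h ▸ hβ t
      rcases hend n1 n3 h13 s h1 with rfl | rfl
      · simp only [c, Set.Icc.coe_zero, AffineMap.lineMap_apply_zero] at h2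
        exact Set.disjoint_left.1 hS hS1.1 h2
      · simp only [c, Set.Icc.coe_one, AffineMap.lineMap_apply_one] at h2
        exact Set.disjoint_left.1 hS hS1.2 h2)
    (fun s t h => by
      have h1 := hball _ (hdm t) (Or.inl (h ▸ hα s))
      have h2 : f (d t) ∈ S₁ := h ▸ hα s
      rcases hend n2 n4 h24 t h1 with rfl | rfl
      · simp only [d, Set.Icc.coe_zero, AffineMap.lineMap_apply_zero] at h2
        exact Set.disjoint_left.1 hS h2 hS2.1
      · simp only [d, Set.Icc.coe_one, AffineMap.lineMap_apply_one] at h2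
        exact Set.disjoint_left.1 hS h2 hS2.2)
    (fun s t h => Set.disjoint_left.1 hS (hα s) (h ▸ hβ t))
  -- a homotopy of pairs of points to a pair of opposite points
  set w : I × I → ℂ := fun x =>
    (((x.1 : ℝ) - 1 / 2 : ℝ) * (z₃ - z₁) - ((x.2 : ℝ) - 1 / 2 : ℝ) * (z₄ - z₂)) / 2 with hw
  have hwc : Continuous w := by fun_prop
  have hwm : ∀ x, w x ∈ Metric.closedBall (0 : ℂ) 1 := by
    intro x
    have hb : ∀ t : I, ∀ a b : ℂ, ‖a‖ = 1 → ‖b‖ = 1 →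
        ‖(((t : ℝ) - 1 / 2 : ℝ) : ℂ) * (a - b)‖ ≤ 1 := by
      intro t a b ha hb
      rw [norm_mul, Complex.norm_real, Real.norm_eq_abs]
      have h1 : |(t : ℝ) - 1 / 2| ≤ 1 / 2 := abs_le.2 ⟨by linarith [t.2.1], by linarith [t.2.2]⟩
      have h2 : ‖a - b‖ ≤ 2 := (norm_sub_le a b).trans (by rw [ha, hb]; norm_num)
      calc _ ≤ (1 / 2 : ℝ) * 2 := mul_le_mul h1 h2 (norm_nonneg _) (by norm_num)
        _ = 1 := by norm_num
    rw [mem_closedBall_zero_iff, hw]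
    simp only
    rw [norm_div, Complex.norm_two]
    have := (norm_sub_le _ _).trans (add_le_add (hb x.1 z₃ z₁ n3 n1) (hb x.2 z₄ z₂ n4 n2))
    linarith
  have hnm : ∀ {z : ℂ}, z ∈ Metric.closedBall (0 : ℂ) 1 → -z ∈ Metric.closedBall (0 : ℂ) 1 := by
    intro z hz; simpa using hz
  -- For `l = 0` this is the pair `c s`, `d t` on the chords, for `l = 1` the pair `w`, `-w`. Here
  -- `w` is half of `c s - d t` with the midpoints of the chords dropped, hence odd under `(s, t) ↦
  -- (1 - s, 1 - t)`.
  set P : I × I × I → ℂ := fun x => AffineMap.lineMap (c x.2.1) (w x.2) (x.1 : ℝ) with hP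
  set Q : I × I × I → ℂ := fun x => AffineMap.lineMap (d x.2.2) (-w x.2) (x.1 : ℝ) with hQ
  have hPm : ∀ x, P x ∈ Metric.closedBall (0 : ℂ) 1 := fun x =>
    (convex_closedBall (0 : ℂ) 1).lineMap_mem (hcm _) (hwm _) x.1.2
  have hQm : ∀ x, Q x ∈ Metric.closedBall (0 : ℂ) 1 := fun x =>
    (convex_closedBall (0 : ℂ) 1).lineMap_mem (hdm _) (hnm (hwm _)) x.1.2
  have hPc : Continuous P := by
    simp only [hP, AffineMap.lineMap_apply_module]; fun_prop
  have hQc : Continuous Q := by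
    simp only [hQ, AffineMap.lineMap_apply_module]; fun_prop
  have hPQ : ∀ l s t : I, (s = 0 ∨ s = 1 ∨ t = 0 ∨ t = 1) → P (l, s, t) ≠ Q (l, s, t) := by
    intro l s t hst heq
    have hre := congrArg Complex.re heq
    have him := congrArg Complex.im heq
    have l0 := l.2.1
    have l1 := l.2.2
    simp only [hP, hQ, hc, hd, hw, AffineMap.lineMap_apply_module, Complex.add_re, Complex.add_im,
      Complex.real_smul, Complex.mul_re, Complex.mul_im, Complex.sub_re, Complex.sub_im,
      Complex.neg_re, Complex.neg_im, Complex.ofReal_re, Complex.ofReal_im, Complex.div_ofNat_re,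
      Complex.div_ofNat_im, zero_mul, sub_zero, add_zero] at hre him
    simp only [orientation] at o123 o124 o134 o234
    generalize (l : ℝ) = l at *
    -- The cross product with `z₄ - z₂` eliminates `t`; in `key2` the one with `z₃ - z₁` eliminates
    -- `s`.
    have key1 : ((s : ℝ) - 1 / 2) * l * ((z₃.re - z₁.re) * (z₄.im - z₂.im) -
        (z₃.im - z₁.im) * (z₄.re - z₂.re)) + (1 - l) * (
        (z₁.re + s * (z₃.re - z₁.re) - z₂.re) * (z₄.im - z₂.im) -
        (z₁.im + s * (z₃.im - z₁.im) - z₂.im) * (z₄.re - z₂.re)) = 0 := by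
      linear_combination (z₄.im - z₂.im) * hre - (z₄.re - z₂.re) * him
    have key2 : ((t : ℝ) - 1 / 2) * l * ((z₄.re - z₂.re) * (z₃.im - z₁.im) -
        (z₄.im - z₂.im) * (z₃.re - z₁.re)) + (1 - l) * (
        (z₂.re + t * (z₄.re - z₂.re) - z₁.re) * (z₃.im - z₁.im) -
        (z₂.im + t * (z₄.im - z₂.im) - z₁.im) * (z₃.re - z₁.re)) = 0 := by
      linear_combination -(z₃.im - z₁.im) * hre + (z₃.re - z₁.re) * him
    -- `x` and `y` will be twice the areas of the two triangles into which a diagonal cuts the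
    -- quadrilateral; `x + y` is, up to sign, the cross product of the diagonals.
    have pos : ∀ {x y : ℝ}, 0 < x → 0 < y → 0 < l * (x + y) / 2 + (1 - l) * x := by
      intro x y hx hy
      have : l * (x + y) / 2 + (1 - l) * x = l * y / 2 + (1 - l / 2) * x := by ring
      rw [this]
      have := mul_pos (show 0 < 1 - l / 2 by linarith) hx
      have := mul_nonneg l0 hy.le
      linarith
    rcases hst with rfl | rfl | rfl | rfl
    · have := pos o124 o234
      simp only [Set.Icc.coe_zero] at key1
      linarith
    · have := pos o234 o124
      simp only [Set.Icc.coe_one] at key1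
      linarith
    · have := pos o123 o134
      simp only [Set.Icc.coe_zero] at key2
      linarith
    · have := pos o134 o123
      simp only [Set.Icc.coe_one] at key2
      linarith
  have hg := logIncrement_boundary_homotopy (g := fun x => f (P x) - f (Q x))
    ((hf.comp_continuous hPc hPm).sub (hf.comp_continuous hQc hQm))
    (fun l s t h => sub_ne_zero.2 fun e => hPQ l s t h (hinj (hPm _) (hQm _) e))
  have hne := logIncrement_boundary_ne_of_odd (g := fun x => f (w x) - f (-w x))
    ((hf.comp_continuous hwc hwm).sub (hf.comp_continuous hwc.neg fun x => hnm (hwm x)))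
    (fun x h => sub_ne_zero.2 fun e => hPQ 1 x.1 x.2 h (by
      simpa [hP, hQ] using hinj (hwm _) (hnm (hwm _)) e))
    (fun s t => by
      have : w (σ s, σ t) = -w (s, t) := by
        simp only [hw, coe_symm_eq]; push_cast; ring
      simp only [this, neg_neg, neg_sub])
  simp only [hP, hQ, Set.Icc.coe_zero, Set.Icc.coe_one, AffineMap.lineMap_apply_zero,
    AffineMap.lineMap_apply_one] at hg
  apply hne
  linear_combination hzero - hg

end Crossing

/-! ### Connected parts of a plane drawing. -/

theorem IsArc.joinedIn {S : Set ℂ} {p q : ℂ} (h : IsArc S p q) : JoinedIn S p q := by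
  obtain ⟨γ, -, h0, h1, rfl⟩ := h
  exact ⟨⟨γ, h0, h1⟩, fun t => ⟨t, rfl⟩⟩

namespace PlaneDrawing

variable {V : Type*} {G : SimpleGraph V}

/-- The part of the drawing formed by the vertices in `K` and the edges between them. -/
def span (D : PlaneDrawing G) (K : Set V) : Set ℂ :=
  D.pos '' K ∪ {z | ∃ e : G.edgeSet, (∀ v ∈ (e : Sym2 V), v ∈ K) ∧ z ∈ D.arc e}

theorem span_subset_support (D : PlaneDrawing G) (K : Set V) : D.span K ⊆ D.support := by
  rintro z (⟨v, -, rfl⟩ | ⟨e, -, he⟩)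
  · exact Or.inl ⟨v, rfl⟩
  · exact Or.inr (Set.mem_iUnion.2 ⟨e, he⟩)

theorem mem_of_pos_mem_span (D : PlaneDrawing G) {K : Set V} {v : V} (h : D.pos v ∈ D.span K) :
    v ∈ K := by
  rcases h with ⟨u, hu, huv⟩ | ⟨e, he, hz⟩
  · exact D.pos_injective huv ▸ hu
  · exact he v (D.mem_of_pos_mem_arc e v hz)

/-- An edge with both ends in `K` differs from one with both ends in `K'`, so their arcs meet only
in vertices, and such a vertex would lie in `K` and in `K'`. -/
theorem disjoint_span (D : PlaneDrawing G) {K K' : Set V} (h : Disjoint K K') :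
    Disjoint (D.span K) (D.span K') := by
  rw [Set.disjoint_left] at h ⊢
  intro z hz hz'
  suffices hr : z ∈ Set.range D.pos by
    obtain ⟨v, rfl⟩ := hr
    exact h (D.mem_of_pos_mem_span hz) (D.mem_of_pos_mem_span hz')
  rcases hz with ⟨u, -, rfl⟩ | ⟨e, he, hze⟩
  · exact ⟨u, rfl⟩
  rcases hz' with ⟨u, -, rfl⟩ | ⟨e', he', hze'⟩
  · exact ⟨u, rfl⟩
  refine D.arc_inter_subset e e' ?_ ⟨hze, hze'⟩
  rintro rfl
  obtain ⟨⟨u, v⟩, huv⟩ := e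
  exact h (he u (Sym2.mem_mk_left u v)) (he' u (Sym2.mem_mk_left u v))

theorem joinedIn_span (D : PlaneDrawing G) {H : SimpleGraph V} (hH : H ≤ G) {K : Set V}
    (hK : ∀ u v, H.Adj u v → u ∈ K → v ∈ K) {u v : V} (h : H.Reachable u v) (hu : u ∈ K) :
    JoinedIn (D.span K) (D.pos u) (D.pos v) := by
  obtain ⟨p⟩ := h
  induction p with
  | nil => exact JoinedIn.refl (Or.inl ⟨_, hu, rfl⟩)
  | @cons u v w huv p ih =>
    have hv := hK u v huv hu
    refine JoinedIn.trans ((D.isArc u v (hH huv)).joinedIn.mono fun z hz => Or.inr ?_) (ih hv)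
    refine ⟨_, fun x hx => ?_, hz⟩
    rcases Sym2.mem_iff.1 hx with rfl | rfl <;> assumption

theorem CyclicOnFace.injective {D : PlaneDrawing G} {F : Set ℂ} {m : ℕ} {x : Fin m → V}
    (h : D.CyclicOnFace F x) : Function.Injective x := by
  obtain ⟨f, θ, -, hinj, hθ, hθI, hx, -⟩ := h
  intro i j hij
  have hb : ∀ i, Complex.exp (θ i * Complex.I) ∈ Metric.closedBall (0 : ℂ) 1 := fun i => by
    simp [Complex.norm_exp_ofReal_mul_I]
  have he := hinj (hb i) (hb j) (by rw [hx, hx, hij])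
  by_contra hne
  wlog hlt : i < j generalizing i j
  · exact this hij.symm he.symm (Ne.symm hne) (lt_of_le_of_ne (not_lt.1 hlt) (Ne.symm hne))
  have h1 := hθ hlt
  have h2 := (hθI i).1
  have h3 := (hθI j).2
  obtain ⟨n, hn⟩ := Complex.exp_eq_exp_iff_exists_int.1 he
  have hn' := congrArg Complex.im hn
  simp at hn'
  have hp := Real.pi_pos
  have h4 : (-1 : ℝ) < n := by nlinarith
  have h5 : (n : ℝ) < 0 := by nlinarith
  norm_cast at h4 h5
  omega

/-- Two subgraphs joining interleaved vertices on a face have a vertex in common. -/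
theorem CyclicOnFace.not_crossing {D : PlaneDrawing G} {F : Set ℂ} (hF : F ⊆ D.supportᶜ) {m : ℕ}
    {x : Fin m → V} (h : D.CyclicOnFace F x) {i j k l : Fin m} (hij : i < j) (hjk : j < k)
    (hkl : k < l) {K K' : Set V} (hK : Disjoint K K')
    (j1 : JoinedIn (D.span K) (D.pos (x i)) (D.pos (x k)))
    (j2 : JoinedIn (D.span K') (D.pos (x j)) (D.pos (x l))) : False := by
  obtain ⟨f, θ, hf, hinj, hθ, hθI, hx, hfF⟩ := h
  have ho : ∀ {i j k : Fin m}, i < j → j < k →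
      0 < orientation (Complex.exp (θ i * Complex.I)) (Complex.exp (θ j * Complex.I))
        (Complex.exp (θ k * Complex.I)) := fun {i j k} h h' =>
    orientation_exp_pos (hθ h) (hθ h') (by linarith [(hθI i).1, (hθI k).2])
  rw [← hx, ← hx] at j1 j2
  refine not_exists_disjoint_paths hf hinj (Complex.norm_exp_ofReal_mul_I _)
    (Complex.norm_exp_ofReal_mul_I _) (Complex.norm_exp_ofReal_mul_I _)
    (Complex.norm_exp_ofReal_mul_I _) (ho hij hjk) (ho hij (hjk.trans hkl))
    (ho (hij.trans hjk) hkl) (ho hjk hkl) (D.disjoint_span hK) j1 j2 fun z hz hzS => ?_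
  by_cases hzi : ∃ i, z = Complex.exp (θ i * Complex.I)
  · obtain ⟨i, rfl⟩ := hzi
    exact Complex.norm_exp_ofReal_mul_I _
  · push Not at hzi
    exact absurd (hzS.elim (D.span_subset_support _ ·) (D.span_subset_support _ ·))
      (hF (hfF z hz hzi))

theorem IsFace.subset_compl_support {D : PlaneDrawing G} {F : Set ℂ} (hF : D.IsFace F) :
    F ⊆ D.supportᶜ := by
  obtain ⟨z, -, rfl⟩ := hF
  exact connectedComponentIn_subset _ _

/-- The connected components of a subgraph induce a noncrossing partition of the vertices that
appear in cyclic order on a face. -/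
theorem CyclicOnFace.reachable_of_interleaved {D : PlaneDrawing G} {F : Set ℂ} (hF : D.IsFace F)
    {m : ℕ} {x : Fin m → V} (h : D.CyclicOnFace F x) {H : SimpleGraph V} (hH : H ≤ G)
    {i j k l : Fin m} (hij : i < j) (hjk : j < k) (hkl : k < l)
    (h1 : H.Reachable (x i) (x k)) (h2 : H.Reachable (x j) (x l)) : H.Reachable (x i) (x j) := by
  by_contra hne
  refine h.not_crossing hF.subset_compl_support hij hjk hkl
    -- Distinct components of `H` are disjoint and closed under adjacency.
    (K := {v | H.Reachable (x i) v}) (K' := {v | H.Reachable (x j) v}) ?_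
    (D.joinedIn_span hH (fun u v huv hu => hu.trans huv.reachable) h1
      (SimpleGraph.Reachable.refl _))
    (D.joinedIn_span hH (fun u v huv hu => hu.trans huv.reachable) h2
      (SimpleGraph.Reachable.refl _))
  exact Set.disjoint_left.2 fun v hv hv' => hne (hv.trans hv'.symm)

end PlaneDrawing

/-! ### Parity in noncrossing pairings. -/

theorem even_card_of_involution {α : Type*} {s : Finset α} (f : α → α)
    (hmaps : ∀ x ∈ s, f x ∈ s) (hinv : ∀ x ∈ s, f (f x) = x) (hne : ∀ x ∈ s, f x ≠ x) :
    Even s.card := by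
  have h : ∑ _x ∈ s, (1 : ZMod 2) = 0 :=
    Finset.sum_involution (fun x _ => f x) (fun _ _ => by decide) (fun x hx _ => hne x hx)
      hmaps hinv
  rw [Finset.sum_const, nsmul_one] at h
  exact (ZMod.natCast_eq_zero_iff_even).1 h

/-- In a noncrossing partition of `0, …, m - 1` into blocks of size two, the members of a block
have different parity. -/
theorem odd_sub_of_noncrossing {m : ℕ} {γ : Type*} (c : Fin m → γ)
    (hc : ∀ g, Even {i | c i = g}.ncard ∧ {i | c i = g}.ncard ≤ 2)
    (hnc : ∀ i j k l, i < j → j < k → k < l → c i = c k → c j = c l → c i = c j)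
    {p r : Fin m} (hpr : p < r) (h : c p = c r) : Odd ((r : ℕ) - p) := by
  classical
  have hblock : ∀ {i j k : Fin m}, c i = c j → c j = c k → i ≠ j → j ≠ k → i ≠ k → False := by
    intro i j k h1 h2 hij hjk hik
    have hsub : (({i, j, k} : Finset (Fin m)) : Set (Fin m)) ⊆ {l | c l = c i} := by
      intro l hl
      simp only [Finset.coe_insert, Finset.coe_singleton, Set.mem_insert_iff,
        Set.mem_singleton_iff] at hl
      rcases hl with rfl | rfl | rfl
      · rfl
      · exact h1.symm
      · exact (h1.trans h2).symm
    have h3 := Set.ncard_le_ncard hsub (Set.toFinite _)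
    rw [Set.ncard_coe_finset, Finset.card_eq_three.2 ⟨i, j, k, hij, hik, hjk, rfl⟩] at h3
    have := (hc (c i)).2
    omega
  have hpartner : ∀ q, ∃ s, s ≠ q ∧ c s = c q := by
    intro q
    by_contra hcon
    push Not at hcon
    have : {i | c i = c q} = {q} := by
      ext s
      refine ⟨fun hs => by_contra fun hne => hcon s hne hs, fun hs => ?_⟩
      rw [Set.mem_singleton_iff.1 hs]; rfl
    have h1 := (hc (c q)).1
    rw [this, Set.ncard_singleton] at h1
    exact absurd h1 (by decide)
  choose s hsne hsc using hpartner
  have hinv : ∀ q, s (s q) = q := fun q => by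
    by_contra hne
    exact hblock (hsc (s q)) (hsc q) (hsne (s q)) (hsne q) hne
  -- A partner outside the interval would give a pair crossing `p`, `r`. So the `r - p - 1` points
  -- strictly between are paired among themselves.
  have hmaps : ∀ q ∈ Finset.Ioo p r, s q ∈ Finset.Ioo p r := by
    intro q hq
    rw [Finset.mem_Ioo] at hq ⊢
    by_contra hcon
    have hpq : c p ≠ c q := fun e => hblock e.symm h hq.1.ne' hpr.ne hq.2.ne
    apply hpq
    have hsp : s q ≠ p := fun e => hpq (e ▸ hsc q)
    have hsr : s q ≠ r := fun e => hpq (h.trans (e ▸ hsc q))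
    rcases lt_or_gt_of_ne hsp with h1 | h1
    · rw [← hnc (s q) p q r h1 hq.1 hq.2 (hsc q) h, hsc]
    · have h2 : r < s q := lt_of_le_of_ne (not_lt.1 fun h2 => hcon ⟨h1, h2⟩) (Ne.symm hsr)
      exact hnc p q r (s q) hq.1 hq.2 h2 h (hsc q).symm
  have heven := even_card_of_involution s hmaps (fun q _ => hinv q) (fun q _ => hsne q)
  rw [Fin.card_Ioo] at heven
  have : (p : ℕ) < r := hpr
  rw [Nat.even_iff] at heven
  rw [Nat.odd_iff]
  omega

/-! ### Matchings as involutions, their superposition and their weights. -/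

section Matchings

variable {V : Type*}

/-- The maps that interchange the ends of the edges of a perfect matching of `G - S` and fix the
vertices in `S`. -/
structure IsMatchingMap (G : SimpleGraph V) (S : Finset V) (σ : V → V) : Prop where
  involutive : Function.Involutive σ
  fixed : ∀ v ∈ S, σ v = v
  adj : ∀ v ∉ S, G.Adj v (σ v)

variable {G : SimpleGraph V} {S S' : Finset V} {σ τ : V → V}

theorem IsMatchingMap.ne_iff (h : IsMatchingMap G S σ) (v : V) : σ v ≠ v ↔ v ∉ S :=
  ⟨fun hv hS => hv (h.fixed v hS), fun hv => (h.adj v hv).ne'⟩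

theorem IsMatchingMap.notMem (h : IsMatchingMap G S σ) {v : V} (hv : v ∉ S) : σ v ∉ S := by
  rw [← h.ne_iff, h.involutive v]
  exact ((h.ne_iff v).2 hv).symm

theorem IsMatchingMap.even_card_sdiff [DecidableEq V] (h : IsMatchingMap G S σ) {K : Finset V}
    (hK : ∀ v ∈ K, σ v ∈ K) : Even (K \ S).card :=
  even_card_of_involution σ (fun v hv => by
      rw [Finset.mem_sdiff] at hv ⊢
      exact ⟨hK v hv.1, h.notMem hv.2⟩)
    (fun v _ => h.involutive v) (fun v hv => (h.ne_iff v).2 (Finset.mem_sdiff.1 hv).2)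

theorem IsMatchingMap.piecewise [DecidableEq V] (h : IsMatchingMap G S σ)
    (h' : IsMatchingMap G S' τ)
    {K : Finset V} (hσ : ∀ v, σ v ∈ K ↔ v ∈ K) (hτ : ∀ v, τ v ∈ K ↔ v ∈ K) :
    IsMatchingMap G (S \ K ∪ S' ∩ K) (K.piecewise τ σ) where
  involutive v := by
    by_cases hv : v ∈ K
    · simp [hv, hτ, h'.involutive v]
    · simp [hv, hσ, h.involutive v]
  fixed v hv := by
    by_cases hK : v ∈ K
    · simp only [hK, Finset.piecewise_eq_of_mem]
      exact h'.fixed v (by simpa [hK] using hv)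
    · simp only [hK, not_false_eq_true, Finset.piecewise_eq_of_notMem]
      exact h.fixed v (by simpa [hK] using hv)
  adj v hv := by
    by_cases hK : v ∈ K
    · simp only [hK, Finset.piecewise_eq_of_mem]
      exact h'.adj v (by simpa [hK] using hv)
    · simp only [hK, not_false_eq_true, Finset.piecewise_eq_of_notMem]
      exact h.adj v (by simpa [hK] using hv)

/-- The union of two matchings. -/
def superposition (σ τ : V → V) : SimpleGraph V :=
  SimpleGraph.fromRel fun u v => v = σ u ∨ v = τ u

theorem IsMatchingMap.superposition_adj (h : IsMatchingMap G S σ) (h' : IsMatchingMap G S' τ)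
    {u v : V} : (superposition σ τ).Adj u v ↔ u ≠ v ∧ (v = σ u ∨ v = τ u) := by
  have h1 : u = σ v ↔ v = σ u :=
    ⟨fun e => by rw [e, h.involutive], fun e => by rw [e, h.involutive]⟩
  have h2 : u = τ v ↔ v = τ u :=
    ⟨fun e => by rw [e, h'.involutive], fun e => by rw [e, h'.involutive]⟩
  rw [superposition, SimpleGraph.fromRel_adj, h1, h2, or_self]

theorem IsMatchingMap.superposition_le (h : IsMatchingMap G S σ) (h' : IsMatchingMap G S' τ) :
    superposition σ τ ≤ G := by
  intro u v huv
  obtain ⟨hne, rfl | rfl⟩ := (h.superposition_adj h').1 huv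
  · exact h.adj u ((h.ne_iff u).1 hne.symm)
  · exact h'.adj u ((h'.ne_iff u).1 hne.symm)

/-- The union does not record which matching an edge comes from. Hence an exchange leaves the
components unchanged and can be undone. -/
theorem superposition_piecewise [DecidableEq V] (K : Finset V) :
    superposition (K.piecewise τ σ) (K.piecewise σ τ) = superposition σ τ := by
  have : ∀ u v, (v = K.piecewise τ σ u ∨ v = K.piecewise σ τ u) ↔ (v = σ u ∨ v = τ u) := by
    intro u v
    by_cases hu : u ∈ K
    · simp [hu, or_comm]
    · simp [hu]
  simp only [superposition, this]

theorem reachable_superposition_left (u v : V) :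
    (superposition σ τ).Reachable u (σ v) ↔ (superposition σ τ).Reachable u v := by
  have h : (superposition σ τ).Reachable v (σ v) := by
    by_cases hv : v = σ v
    · rw [← hv]
    · exact SimpleGraph.Adj.reachable ((SimpleGraph.fromRel_adj _ _ _).2 ⟨hv, Or.inl (Or.inl rfl)⟩)
  exact ⟨fun hu => hu.trans h.symm, fun hu => hu.trans h⟩

theorem reachable_superposition_right (u v : V) :
    (superposition σ τ).Reachable u (τ v) ↔ (superposition σ τ).Reachable u v := by
  have h : superposition σ τ = superposition τ σ := by simp only [superposition, or_comm]
  rw [h]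
  exact reachable_superposition_left u v

/-- The edges with an end in `K` of the matching given by `σ`. -/
def matchingEdges [DecidableEq V] (σ : V → V) (K : Finset V) : Finset (Sym2 V) :=
  (K.filter fun v => σ v ≠ v).image fun v => s(v, σ v)

theorem matchingEdges_congr [DecidableEq V] {K : Finset V} (h : ∀ v ∈ K, σ v = τ v) :
    matchingEdges σ K = matchingEdges τ K := by
  ext e
  simp only [matchingEdges, Finset.mem_image, Finset.mem_filter]
  constructor <;> rintro ⟨v, ⟨hv, hne⟩, rfl⟩ <;>
    exact ⟨v, ⟨hv, by simpa [h v hv] using hne⟩, by rw [h v hv]⟩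

variable [Fintype V] [DecidableEq V]

open Classical in
/-- The vertex set of the component of `u` in the union of two matchings. -/
noncomputable def component (σ τ : V → V) (u : V) : Finset V :=
  Finset.univ.filter fun v => (superposition σ τ).Reachable u v

theorem mem_component {u v : V} :
    v ∈ component σ τ u ↔ (superposition σ τ).Reachable u v := by
  simp [component]

/-- The component is stable under both maps, so each of them pairs off its vertices outside its own
deleted set; both intersections have the parity of the component. -/
theorem even_card_component_inter (h : IsMatchingMap G S σ) (h' : IsMatchingMap G S' τ)
    (hS : Disjoint S S') (u : V) : Even (component σ τ u ∩ (S ∪ S')).card := by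
  have e1 := h.even_card_sdiff (K := component σ τ u) fun v hv => by
    rwa [mem_component, reachable_superposition_left, ← mem_component]
  have e2 := h'.even_card_sdiff (K := component σ τ u) fun v hv => by
    rwa [mem_component, reachable_superposition_right, ← mem_component]
  rw [Finset.inter_union_distrib_left, Finset.card_union_of_disjoint
    (hS.mono Finset.inter_subset_right Finset.inter_subset_right)]
  have c1 := Finset.card_sdiff_add_card_inter (component σ τ u) S
  have c2 := Finset.card_sdiff_add_card_inter (component σ τ u) S'
  rw [Nat.even_iff] at e1 e2 ⊢
  omega

/-- Degrees are at most 2, and at most 1 at deleted vertices, while a connected graph on `c`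
vertices has at least `c - 1` edges. With `t` deleted vertices, `2 (c - 1) + t ≤ 2 c`. -/
theorem card_component_inter_le (h : IsMatchingMap G S σ) (h' : IsMatchingMap G S' τ) (u : V) :
    (component σ τ u ∩ (S ∪ S')).card ≤ 2 := by
  classical
  set H := superposition σ τ with hH
  set C := H.connectedComponentMk u with hC
  have hmem : ∀ v, v ∈ component σ τ u ↔ v ∈ C.supp := by
    intro v
    rw [mem_component, SimpleGraph.ConnectedComponent.mem_supp_iff, hC,
      SimpleGraph.ConnectedComponent.eq]
    exact ⟨SimpleGraph.Reachable.symm, SimpleGraph.Reachable.symm⟩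
  have hconn : (H.induce C.supp).Connected := C.connected_toSimpleGraph
  have hcard := hconn.card_vert_le_card_edgeSet_add_one
  have hsum := (H.induce C.supp).sum_degrees_eq_twice_card_edges
  have hdeg : ∀ v : C.supp,
      (H.induce C.supp).degree v + (if (v : V) ∈ S ∪ S' then 1 else 0) ≤ 2 := by
    intro v
    have hsub : ((H.induce C.supp).neighborFinset v).map (Function.Embedding.subtype _) ⊆
        ({σ v, τ v} : Finset V).erase v := by
      intro x hx
      obtain ⟨y, hy, rfl⟩ := Finset.mem_map.1 hx
      rw [SimpleGraph.mem_neighborFinset, SimpleGraph.comap_adj] at hy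
      obtain ⟨hne, hst⟩ := (h.superposition_adj h').1 hy
      exact Finset.mem_erase.2 ⟨hne.symm, by simpa using hst⟩
    have hle := Finset.card_le_card hsub
    rw [Finset.card_map, SimpleGraph.card_neighborFinset_eq_degree] at hle
    by_cases hv : (v : V) ∈ S ∪ S'
    · have hv' : (v : V) ∈ ({σ v, τ v} : Finset V) := by
        rcases Finset.mem_union.1 hv with hv | hv
        · simp [h.fixed _ hv]
        · simp [h'.fixed _ hv]
      rw [Finset.card_erase_of_mem hv'] at hle
      have := Finset.card_le_two (a := σ v) (b := τ v)
      simp only [hv, if_true]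
      omega
    · have := (Finset.card_erase_le (s := ({σ v, τ v} : Finset V)) (a := (v : V))).trans
        Finset.card_le_two
      simp only [hv, if_false]
      omega
  have htotal := Finset.sum_le_sum fun (v : C.supp) (_ : v ∈ Finset.univ) => hdeg v
  rw [Finset.sum_add_distrib, hsum, Finset.sum_const, Finset.card_univ, smul_eq_mul] at htotal
  have hT : ∑ v : C.supp, (if (v : V) ∈ S ∪ S' then 1 else 0) =
      (component σ τ u ∩ (S ∪ S')).card := by
    rw [Finset.sum_boole, Nat.cast_id, ← Finset.card_map (Function.Embedding.subtype _)]
    congr 1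
    ext v
    simp only [Finset.mem_map, Finset.mem_filter, Finset.mem_univ, true_and, Finset.mem_inter, hmem]
    constructor
    · rintro ⟨x, hx, rfl⟩
      exact ⟨x.2, hx⟩
    · exact fun hv => ⟨⟨v, hv.1⟩, hv.2, rfl⟩
  rw [hT] at htotal
  rw [Nat.card_eq_fintype_card, Nat.card_eq_fintype_card, ← SimpleGraph.edgeFinset_card] at hcard
  omega

variable {R : Type*} [CommSemiring R]

/-- The weight of the matching given by `σ`. -/
def matchingWeight (w : Sym2 V → R) (σ : V → V) : R :=
  ∏ e ∈ matchingEdges σ Finset.univ, w e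

theorem matchingWeight_eq_mul (w : Sym2 V → R) {K : Finset V} (hσ : ∀ v, σ v ∈ K ↔ v ∈ K) :
    matchingWeight w σ =
      (∏ e ∈ matchingEdges σ K, w e) * ∏ e ∈ matchingEdges σ Kᶜ, w e := by
  rw [matchingWeight, ← Finset.prod_union]
  · rw [matchingEdges, matchingEdges, matchingEdges, ← Finset.image_union, ← Finset.filter_union,
      Finset.union_compl]
  · rw [Finset.disjoint_left]
    intro e he he'
    simp only [matchingEdges, Finset.mem_image, Finset.mem_filter] at he he'
    obtain ⟨v, ⟨hv, -⟩, rfl⟩ := he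
    obtain ⟨v', ⟨hv', -⟩, he⟩ := he'
    rw [Finset.mem_compl] at hv'
    rcases Sym2.eq_iff.1 he with ⟨rfl, -⟩ | ⟨rfl, -⟩
    · exact hv' hv
    · exact hv' ((hσ v).2 hv)

/-- Both weights factor into parts inside and outside `K`; the exchange only permutes the four
factors. -/
theorem matchingWeight_piecewise_mul (w : Sym2 V → R) {K : Finset V}
    (hσ : ∀ v, σ v ∈ K ↔ v ∈ K) (hτ : ∀ v, τ v ∈ K ↔ v ∈ K) :
    matchingWeight w (K.piecewise τ σ) * matchingWeight w (K.piecewise σ τ) =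
      matchingWeight w σ * matchingWeight w τ := by
  have hp : ∀ {f g : V → V}, (∀ v, f v ∈ K ↔ v ∈ K) → (∀ v, g v ∈ K ↔ v ∈ K) →
      matchingWeight w (K.piecewise f g) =
        (∏ e ∈ matchingEdges f K, w e) * ∏ e ∈ matchingEdges g Kᶜ, w e := by
    intro f g hf hg
    rw [matchingWeight_eq_mul w (K := K) fun v => by by_cases hv : v ∈ K <;> simp [hv, hf, hg],
      matchingEdges_congr (τ := f) fun v hv => by simp [hv],
      matchingEdges_congr (τ := g) (K := Kᶜ) fun v hv => by simp [Finset.mem_compl.1 hv]]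
  rw [hp hτ hσ, hp hσ hτ, matchingWeight_eq_mul w hσ, matchingWeight_eq_mul w hτ]
  ring

open Classical in
-- A general `φ` covers both the inclusion of the remaining vertices and, for empty `S`, the
-- identity.
theorem matchingSum_comap {W : Type*} {instW : Fintype W} (φ : W → V) (hφ : Function.Injective φ)
    (hS : ∀ v, v ∈ S ↔ v ∉ Set.range φ) (w : Sym2 V → R) :
    matchingSum (G.comap φ) (fun e => w (e.map φ)) =
      ∑ σ : V → V with IsMatchingMap G S σ, matchingWeight w σ := by
  have hmem : ∀ u, φ u ∉ S := fun u => by simp [hS]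
  have hmate : ∀ {σ : V → V}, IsMatchingMap G S σ → ∀ u, ∃ v, φ v = σ (φ u) := fun {σ} h u => by
    simpa [hS] using h.notMem (hmem u)
  symm
  refine Finset.sum_bij (fun σ hσ => ⟨
    { verts := Set.univ
      Adj := fun u v => σ (φ u) = φ v
      adj_sub := fun {u v} huv => by
        have h := (Finset.mem_filter.1 hσ).2
        rw [SimpleGraph.comap_adj, ← huv]
        exact h.adj _ (hmem u)
      edge_vert := fun _ => trivial
      symm := ⟨fun u v huv => by
        have h := (Finset.mem_filter.1 hσ).2
        rw [← huv, h.involutive]⟩ }, ?_⟩) ?_ ?_ ?_ ?_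
  · have h := (Finset.mem_filter.1 hσ).2
    refine ⟨fun u _ => ?_, fun _ => trivial⟩
    obtain ⟨v, hv⟩ := hmate h u
    exact ⟨v, hv.symm, fun v' (hv' : σ (φ u) = φ v') => hφ (hv'.symm.trans hv.symm)⟩
  · exact fun _ _ => Finset.mem_univ _
  · intro σ hσ τ hτ hst
    have h := (Finset.mem_filter.1 hσ).2
    have h' := (Finset.mem_filter.1 hτ).2
    ext v
    by_cases hv : v ∈ S
    · rw [h.fixed v hv, h'.fixed v hv]
    · obtain ⟨u, rfl⟩ : ∃ u, φ u = v := by simpa [hS] using hv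
      obtain ⟨x, hx⟩ := hmate h u
      have hadj := congrArg (fun P => SimpleGraph.Subgraph.Adj P.1 u x) hst
      simp only [eq_iff_iff] at hadj
      rw [← hx, hadj.1 hx.symm]
  · rintro ⟨P, hP, hspan⟩ -
    have hex : ∀ u, ∃! v, P.Adj u v := fun u => hP (hspan u)
    choose μ hμ hμu using hex
    have hμi : ∀ u, μ (μ u) = u := fun u => (hμu _ _ (hμ u).symm).symm
    set σ : V → V := Function.extend φ (φ ∘ μ) id with hσdef
    have hσ : ∀ u, σ (φ u) = φ (μ u) := fun u => hφ.extend_apply _ _ _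
    have hσ' : ∀ v ∈ S, σ v = v := fun v hv => Function.extend_apply' _ _ _ ((hS v).1 hv)
    refine ⟨σ, Finset.mem_filter.2 ⟨Finset.mem_univ _, ⟨fun v => ?_, hσ', fun v hv => ?_⟩⟩, ?_⟩
    · by_cases hv : v ∈ S
      · rw [hσ' v hv, hσ' v hv]
      · obtain ⟨u, rfl⟩ : ∃ u, φ u = v := by simpa [hS] using hv
        rw [hσ, hσ, hμi]
    · obtain ⟨u, rfl⟩ : ∃ u, φ u = v := by simpa [hS] using hv
      rw [hσ]
      exact P.adj_sub (hμ u)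
    · apply Subtype.ext
      refine SimpleGraph.Subgraph.ext (Set.eq_univ_of_forall hspan).symm ?_
      ext u v
      simp only [hσ, hφ.eq_iff]
      exact ⟨fun e => e ▸ hμ u, fun e => (hμu u v e).symm⟩
  · intro σ hσ
    have h := (Finset.mem_filter.1 hσ).2
    rw [matchingWeight, ← Finset.prod_image (g := Sym2.map φ) (f := w)
      (Sym2.map.injective hφ).injOn]
    congr 1
    ext e
    simp only [matchingEdges, Finset.mem_image, Finset.mem_filter, Finset.mem_univ, true_and,
      Set.mem_toFinset]
    constructor
    · rintro ⟨v, hv, rfl⟩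
      obtain ⟨u, rfl⟩ : ∃ u, φ u = v := by simpa [hS] using (h.ne_iff v).1 hv
      obtain ⟨x, hx⟩ := hmate h u
      exact ⟨s(u, x), hx.symm, by rw [Sym2.map_mk, hx]⟩
    · rintro ⟨⟨u, x⟩, hux, rfl⟩
      have hux' : σ (φ u) = φ x := hux
      exact ⟨φ u, (h.ne_iff _).2 (hmem u), by rw [hux']; rfl⟩

open Classical in
theorem matchingSumDelete_eq (G : SimpleGraph V) (w : Sym2 V → R) (S : Finset V) :
    matchingSumDelete G w S = ∑ σ : V → V with IsMatchingMap G S σ, matchingWeight w σ :=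
  matchingSum_comap Subtype.val Subtype.val_injective (by simp) w

theorem matchingSumDelete_empty (G : SimpleGraph V) (w : Sym2 V → R) :
    matchingSumDelete G w ∅ = matchingSum G w := by
  classical
  rw [matchingSumDelete_eq,
    ← matchingSum_comap (instW := inferInstance) id Function.injective_id (by simp)]
  simp

end Matchings

/-! ### The exchange along the path from `a j`, and the condensation identity. -/

section Condensation

variable {V : Type*} {k : ℕ}

theorem interleave_even (a b : Fin k → V) (i : Fin k) (h : 2 * (i : ℕ) < 2 * k) :
    interleave a b ⟨2 * i, h⟩ = a i := by
  simp [interleave]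

theorem interleave_odd (a b : Fin k → V) (i : Fin k) (h : 2 * (i : ℕ) + 1 < 2 * k) :
    interleave a b ⟨2 * i + 1, h⟩ = b i := by
  have h1 : (2 * (i : ℕ) + 1) % 2 = 1 := by omega
  have h2 : (2 * (i : ℕ) + 1) / 2 = i := by omega
  simp [interleave, h1, h2]

theorem left_ne_right_of_interleave {a b : Fin k → V} (h : Function.Injective (interleave a b))
    (i j : Fin k) : a i ≠ b j := by
  rw [← interleave_even a b i (by omega), ← interleave_odd a b j (by omega)]
  intro e
  have := congrArg Fin.val (h e)
  simp only at this
  omega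

theorem injective_left_of_interleave {a b : Fin k → V}
    (h : Function.Injective (interleave a b)) : Function.Injective a := by
  intro i j e
  rw [← interleave_even a b i (by omega), ← interleave_even a b j (by omega)] at e
  have := congrArg Fin.val (h e)
  simp only at this
  omega

theorem injective_right_of_interleave {a b : Fin k → V}
    (h : Function.Injective (interleave a b)) : Function.Injective b := by
  intro i j e
  rw [← interleave_odd a b i (by omega), ← interleave_odd a b j (by omega)] at e
  have := congrArg Fin.val (h e)
  simp only at this
  omega

variable [DecidableEq V]

theorem image_interleave (a b : Fin k → V) :
    Finset.univ.image (interleave a b) = Finset.univ.image a ∪ Finset.univ.image b := by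
  ext v
  simp only [Finset.mem_image, Finset.mem_univ, true_and, Finset.mem_union]
  constructor
  · rintro ⟨m, rfl⟩
    by_cases hm : (m : ℕ) % 2 = 0
    · exact Or.inl ⟨⟨m / 2, by omega⟩, by simp [interleave, hm]⟩
    · exact Or.inr ⟨⟨m / 2, by omega⟩, by simp [interleave, hm]⟩
  · rintro (⟨i, rfl⟩ | ⟨i, rfl⟩)
    · exact ⟨_, interleave_even a b i (by omega)⟩
    · exact ⟨_, interleave_odd a b i (by omega)⟩

theorem subset_pair_iff_eq {Y : Finset V} {x y : V} :
    Y ⊆ {x, y} ↔ Y = ∅ ∨ Y = {x} ∨ Y = {y} ∨ Y = {x, y} := by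
  rw [← Finset.coe_subset, Finset.coe_pair, Set.subset_pair_iff_eq]
  norm_cast

/-- Exchange of `Y` and `B \ Y` inside `K`. -/
def exchange (B K Y : Finset V) : Finset V := Y \ K ∪ (B \ Y) ∩ K

theorem mem_exchange {B K Y : Finset V} {v : V} :
    v ∈ exchange B K Y ↔ v ∈ Y ∧ v ∉ K ∨ (v ∈ B ∧ v ∉ Y) ∧ v ∈ K := by
  simp [exchange]

theorem exchange_subset {B K Y : Finset V} (hY : Y ⊆ B) : exchange B K Y ⊆ B :=
  Finset.union_subset (Finset.sdiff_subset.trans hY)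
    (Finset.inter_subset_left.trans Finset.sdiff_subset)

theorem exchange_exchange {B K Y : Finset V} (hY : Y ⊆ B) :
    exchange B K (exchange B K Y) = Y := by
  ext v
  have := @hY v
  simp only [mem_exchange]
  tauto

/-- Modulo 2 the exchange adds `(K ∩ B).card` to the size of `Y`. -/
theorem odd_card_exchange_iff {B K Y : Finset V} (hY : Y ⊆ B) (hK : Odd (K ∩ B).card) :
    Odd (exchange B K Y).card ↔ Even Y.card := by
  have h1 : (exchange B K Y).card = (Y \ K).card + ((B \ Y) ∩ K).card :=
    Finset.card_union_of_disjoint (Finset.disjoint_left.2 fun v hv hv' =>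
      (Finset.mem_sdiff.1 hv).2 (Finset.mem_inter.1 hv').2)
  have h2 : (K ∩ B).card = (Y ∩ K).card + ((B \ Y) ∩ K).card := by
    rw [← Finset.card_union_of_disjoint (Finset.disjoint_left.2 fun v hv hv' =>
      (Finset.mem_sdiff.1 (Finset.mem_inter.1 hv').1).2 (Finset.mem_inter.1 hv).1),
      ← Finset.union_inter_distrib_right, Finset.union_sdiff_of_subset hY, Finset.inter_comm]
  have h3 := Finset.card_sdiff_add_card_inter Y K
  rw [Nat.odd_iff] at hK ⊢
  rw [Nat.even_iff]
  omega

/-- This and the next three identities match the deleted sets given by `IsMatchingMap.piecewise`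
with those in the sums: two for odd to even, two for the way back. `K` meets `A` only in `x`. -/
theorem exchange_eq {A B K Y : Finset V} {x : V} (hY : Y ⊆ B)
    (hAB : ∀ v ∈ A, v ∉ B) (hK : ∀ v, v ∈ K ∧ v ∈ A ↔ v = x) :
    exchange B K Y = ({x} ∪ Y) \ K ∪ ((A \ {x}) ∪ (B \ Y)) ∩ K := by
  ext v
  have h1 := @hY v
  have h2 := hAB v
  have h3 := hK v
  simp only [mem_exchange, Finset.mem_union, Finset.mem_sdiff, Finset.mem_singleton,
    Finset.mem_inter]
  grind

theorem union_sdiff_exchange {A B K Y : Finset V} {x : V} (hY : Y ⊆ B)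
    (hAB : ∀ v ∈ A, v ∉ B) (hK : ∀ v, v ∈ K ∧ v ∈ A ↔ v = x) :
    A ∪ (B \ exchange B K Y) = ((A \ {x}) ∪ (B \ Y)) \ K ∪ ({x} ∪ Y) ∩ K := by
  ext v
  have h1 := @hY v
  have h2 := hAB v
  have h3 := hK v
  simp only [mem_exchange, Finset.mem_union, Finset.mem_sdiff, Finset.mem_singleton,
    Finset.mem_inter]
  grind

theorem singleton_union_exchange {A B K Y : Finset V} {x : V} (hY : Y ⊆ B)
    (hAB : ∀ v ∈ A, v ∉ B) (hK : ∀ v, v ∈ K ∧ v ∈ A ↔ v = x) :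
    {x} ∪ exchange B K Y = Y \ K ∪ (A ∪ (B \ Y)) ∩ K := by
  ext v
  have h1 := @hY v
  have h2 := hAB v
  have h3 := hK v
  simp only [mem_exchange, Finset.mem_union, Finset.mem_sdiff, Finset.mem_singleton,
    Finset.mem_inter]
  grind

theorem sdiff_union_sdiff_exchange {A B K Y : Finset V} {x : V} (hY : Y ⊆ B)
    (hAB : ∀ v ∈ A, v ∉ B) (hK : ∀ v, v ∈ K ∧ v ∈ A ↔ v = x) :
    (A \ {x}) ∪ (B \ exchange B K Y) = (A ∪ (B \ Y)) \ K ∪ Y ∩ K := by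
  ext v
  have h1 := @hY v
  have h2 := hAB v
  have h3 := hK v
  simp only [mem_exchange, Finset.mem_union, Finset.mem_sdiff, Finset.mem_singleton,
    Finset.mem_inter]
  grind

variable [Fintype V] {G : SimpleGraph V} {D : PlaneDrawing G} {F : Set ℂ} {a b : Fin k → V}
  {S S' : Finset V} {σ τ : V → V}

/-- The path of the superposition that starts at `a j` ends at some `b i`. -/
theorem component_inter (hF : D.IsFace F) (hab : D.CyclicOnFace F (interleave a b))
    (h : IsMatchingMap G S σ) (h' : IsMatchingMap G S' τ) (hS : Disjoint S S')
    (hT : S ∪ S' = Finset.univ.image a ∪ Finset.univ.image b) (j : Fin k) :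
    component σ τ (a j) ∩ Finset.univ.image a = {a j} ∧
      Odd (component σ τ (a j) ∩ Finset.univ.image b).card := by
  have hinj := hab.injective
  have hA : component σ τ (a j) ∩ Finset.univ.image a = {a j} := by
    ext v
    simp only [Finset.mem_inter, Finset.mem_image, Finset.mem_univ, true_and,
      Finset.mem_singleton, mem_component]
    constructor
    · rintro ⟨hr, i, rfl⟩
      by_contra hne
      have key : ∀ i j : Fin k, i < j → ¬ (superposition σ τ).Reachable (a i) (a j) := by
        intro i j hij hr
        -- `a i` and `a j` stand at the even positions `2 * i` and `2 * j`, so their distance cannot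
        -- be odd.
        have hodd := odd_sub_of_noncrossing
          (fun m => (superposition σ τ).connectedComponentMk (interleave a b m))
          (fun g => by
            induction g using SimpleGraph.ConnectedComponent.ind with | _ u
            have hc : {m | (superposition σ τ).connectedComponentMk (interleave a b m) =
                (superposition σ τ).connectedComponentMk u}.ncard =
                (component σ τ u ∩ (S ∪ S')).card := by
              rw [← Set.ncard_image_of_injective _ hinj, ← Set.ncard_coe_finset, hT,
                ← image_interleave]
              congr 1
              ext v
              simp only [Set.mem_image, Set.mem_ofPred_eq, SimpleGraph.ConnectedComponent.eq,
                Finset.coe_inter, Set.mem_inter_iff, Finset.mem_coe, mem_component,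
                Finset.mem_image, Finset.mem_univ, true_and]
              constructor
              · rintro ⟨m, hm, rfl⟩
                exact ⟨hm.symm, m, rfl⟩
              · rintro ⟨hm, m, rfl⟩
                exact ⟨m, hm.symm, rfl⟩
            rw [hc]
            exact ⟨even_card_component_inter h h' hS u, card_component_inter_le h h' u⟩)
          (fun i j k l hij hjk hkl h1 h2 => by
            rw [SimpleGraph.ConnectedComponent.eq] at *
            exact hab.reachable_of_interleaved hF (h.superposition_le h') hij hjk hkl h1 h2)
          (p := ⟨2 * i, by omega⟩) (r := ⟨2 * j, by omega⟩)
          (by rw [Fin.mk_lt_mk]; have : (i : ℕ) < j := hij; omega)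
          (by rw [interleave_even, interleave_even]; exact SimpleGraph.ConnectedComponent.sound hr)
        rw [Nat.odd_iff] at hodd
        simp only at hodd
        omega
      rcases lt_trichotomy i j with hij | rfl | hij
      · exact key i j hij hr.symm
      · exact hne rfl
      · exact key j i hij hr
    · rintro rfl
      exact ⟨SimpleGraph.Reachable.refl _, j, rfl⟩
  refine ⟨hA, ?_⟩
  have heven := even_card_component_inter h h' hS (a j)
  have hAB : Disjoint (Finset.univ.image a) (Finset.univ.image b) := by
    rw [Finset.disjoint_left]
    simp only [Finset.mem_image, Finset.mem_univ, true_and]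
    rintro v ⟨i, rfl⟩ ⟨i', h⟩
    exact left_ne_right_of_interleave hinj i i' h.symm
  rw [hT, Finset.inter_union_distrib_left, Finset.card_union_of_disjoint
    (hAB.mono Finset.inter_subset_right Finset.inter_subset_right), hA,
    Finset.card_singleton] at heven
  rw [Nat.even_iff] at heven
  rw [Nat.odd_iff]
  omega

theorem component_piecewise (K : Finset V) (u : V) :
    component (K.piecewise τ σ) (K.piecewise σ τ) u = component σ τ u := by
  ext v
  rw [mem_component, mem_component, superposition_piecewise]

variable {R : Type*} [CommSemiring R]

/-- Exchange of the two matchings, given by `σ` and `τ`, on the component of `u`. -/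
noncomputable def exchangeAt (B : Finset V) (u : V) (x : Σ _ : Finset V, (V → V) × (V → V)) :
    Σ _ : Finset V, (V → V) × (V → V) :=
  ⟨exchange B (component x.2.1 x.2.2 u) x.1, (component x.2.1 x.2.2 u).piecewise x.2.2 x.2.1,
    (component x.2.1 x.2.2 u).piecewise x.2.1 x.2.2⟩

theorem exchangeAt_exchangeAt {B : Finset V} (u : V) {x : Σ _ : Finset V, (V → V) × (V → V)}
    (hx : x.1 ⊆ B) : exchangeAt B u (exchangeAt B u x) = x := by
  obtain ⟨Y, σ, τ⟩ := x
  have hp : ∀ (K K' : Finset V) (σ τ : V → V), K' = K →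
      K'.piecewise (K.piecewise σ τ) (K.piecewise τ σ) = σ := by
    rintro _ K σ τ rfl
    ext v
    by_cases hv : v ∈ K <;> simp [hv]
  refine Sigma.ext ?_ (heq_of_eq (Prod.ext (hp _ _ _ _ ?_) (hp _ _ _ _ ?_)))
  · simp only [exchangeAt, component_piecewise, exchange_exchange hx]
  all_goals exact component_piecewise _ _

/-- The component of `a j` contains no other vertex of `A`, so exactly `a j` changes sides within
`A`; it contains an odd number of vertices of `B`, so the parity of the index set flips. -/
theorem condensation (w : Sym2 V → R) (hF : D.IsFace F)
    (hab : D.CyclicOnFace F (interleave a b)) (j : Fin k) {A B : Finset V}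
    (hA : A = Finset.univ.image a) (hB : B = Finset.univ.image b) :
    ∑ Y ∈ B.powerset with Odd Y.card,
        matchingSumDelete G w ({a j} ∪ Y) * matchingSumDelete G w ((A \ {a j}) ∪ (B \ Y)) =
      ∑ W ∈ B.powerset with Even W.card,
        matchingSumDelete G w W * matchingSumDelete G w (A ∪ (B \ W)) := by
  classical
  have haA : a j ∈ A := by simp [hA]
  have hAB : ∀ v ∈ A, v ∉ B := by
    simp only [hA, hB, Finset.mem_image, Finset.mem_univ, true_and]
    rintro v ⟨i, rfl⟩ ⟨i', h⟩
    exact left_ne_right_of_interleave hab.injective i i' h.symm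
  have hcomp : ∀ {S S' : Finset V} {σ τ : V → V}, IsMatchingMap G S σ → IsMatchingMap G S' τ →
      Disjoint S S' → S ∪ S' = A ∪ B → component σ τ (a j) ∩ A = {a j} ∧
      Odd (component σ τ (a j) ∩ B).card := by
    intro S S' σ τ h h' hS hT
    subst hA hB
    exact component_inter hF hab h h' hS hT j
  have hKA : ∀ {K : Finset V}, K ∩ A = {a j} → ∀ v, v ∈ K ∧ v ∈ A ↔ v = a j := by
    intro K hK v
    rw [← Finset.mem_inter, hK, Finset.mem_singleton]
  have hσK : ∀ (σ τ : V → V) v, σ v ∈ component σ τ (a j) ↔ v ∈ component σ τ (a j) := by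
    intro σ τ v
    rw [mem_component, mem_component, reachable_superposition_left]
  have hτK : ∀ (σ τ : V → V) v, τ v ∈ component σ τ (a j) ↔ v ∈ component σ τ (a j) := by
    intro σ τ v
    rw [mem_component, mem_component, reachable_superposition_right]
  -- Both sides become sums over triples of a subset of `B` and two matching maps.
  simp only [matchingSumDelete_eq, Finset.sum_mul_sum, ← Finset.sum_product', Finset.sum_sigma']
  refine Finset.sum_nbij' (exchangeAt B (a j)) (exchangeAt B (a j)) ?_ ?_ ?_ ?_ ?_
  · rintro ⟨Y, σ, τ⟩ hx
    simp only [Finset.mem_sigma, Finset.mem_product, Finset.mem_filter, Finset.mem_univ, true_and,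
      Finset.mem_powerset] at hx
    obtain ⟨⟨hY, hodd⟩, h, h'⟩ := hx
    obtain ⟨hK, hKB⟩ := hcomp h h'
      (Finset.disjoint_left.2 fun v => by
        have := @hY v; have := hAB v
        simp only [Finset.mem_union, Finset.mem_sdiff, Finset.mem_singleton]
        rintro (rfl | hv) <;> tauto)
      (by
        ext v
        have := @hY v
        by_cases hv : v = a j <;> simp [hv] <;> tauto)
    have hp := h.piecewise h' (hσK σ τ) (hτK σ τ)
    have hp' := h'.piecewise h (hτK σ τ) (hσK σ τ)
    simp only [exchangeAt, Finset.mem_sigma, Finset.mem_product, Finset.mem_filter,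
      Finset.mem_univ, true_and, Finset.mem_powerset]
    refine ⟨⟨exchange_subset hY, ?_⟩, ?_, ?_⟩
    · rw [← Nat.not_odd_iff_even, odd_card_exchange_iff hY hKB, Nat.not_even_iff_odd]
      exact hodd
    · rw [exchange_eq hY hAB (hKA hK)]
      exact hp
    · rw [union_sdiff_exchange hY hAB (hKA hK)]
      exact hp'
  · rintro ⟨Y, σ, τ⟩ hx
    simp only [Finset.mem_sigma, Finset.mem_product, Finset.mem_filter, Finset.mem_univ, true_and,
      Finset.mem_powerset] at hx
    obtain ⟨⟨hY, heven⟩, h, h'⟩ := hx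
    obtain ⟨hK, hKB⟩ := hcomp h h'
      (Finset.disjoint_left.2 fun v => by
        have := @hY v; have := hAB v
        simp only [Finset.mem_union, Finset.mem_sdiff]
        tauto)
      (by
        ext v
        have := @hY v
        simp only [Finset.mem_union, Finset.mem_sdiff]
        tauto)
    have hp := h.piecewise h' (hσK σ τ) (hτK σ τ)
    have hp' := h'.piecewise h (hτK σ τ) (hσK σ τ)
    simp only [exchangeAt, Finset.mem_sigma, Finset.mem_product, Finset.mem_filter,
      Finset.mem_univ, true_and, Finset.mem_powerset]
    refine ⟨⟨exchange_subset hY, (odd_card_exchange_iff hY hKB).2 heven⟩, ?_, ?_⟩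
    · rw [singleton_union_exchange hY hAB (hKA hK)]
      exact hp
    · rw [sdiff_union_sdiff_exchange hY hAB (hKA hK)]
      exact hp'
  · rintro ⟨Y, σ, τ⟩ hx
    simp only [Finset.mem_sigma, Finset.mem_filter, Finset.mem_powerset] at hx
    exact exchangeAt_exchangeAt _ hx.1.1
  · rintro ⟨Y, σ, τ⟩ hx
    simp only [Finset.mem_sigma, Finset.mem_filter, Finset.mem_powerset] at hx
    exact exchangeAt_exchangeAt _ hx.1.1
  · rintro ⟨Y, σ, τ⟩ -
    exact (matchingWeight_piecewise_mul w (hσK σ τ) (hτK σ τ)).symm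

end Condensation

end PlaneCondensation

open PlaneCondensation in
theorem theorem2p2 {V R : Type*} [Fintype V] [DecidableEq V] [CommSemiring R]
    (G : SimpleGraph V) (w : Sym2 V → R) (D : PlaneDrawing G)
    (n k : ℕ) (hcard : Fintype.card V = 2 * n) (hk : 2 ≤ k) (hkn : k ≤ n)
    (F : Set ℂ) (hF : D.IsFace F)
    (a b : Fin k → V) (hab : D.CyclicOnFace F (interleave a b))
    (A B : Finset V) (hA : A = Finset.univ.image a) (hB : B = Finset.univ.image b) :
    (∀ j : Fin k,
      ∑ Y ∈ B.powerset with Odd Y.card,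
        matchingSumDelete G w ({a j} ∪ Y) * matchingSumDelete G w ((A \ {a j}) ∪ (B \ Y)) =
      ∑ W ∈ B.powerset with Even W.card,
        matchingSumDelete G w W * matchingSumDelete G w (A ∪ (B \ W))) ∧
    (k = 2 → ∀ i j : Fin k, i ≠ j →
      matchingSum G w * matchingSumDelete G w {a i, b i, a j, b j} +
          matchingSumDelete G w {a i, a j} * matchingSumDelete G w {b i, b j} =
        matchingSumDelete G w {a i, b i} * matchingSumDelete G w {a j, b j} +
          matchingSumDelete G w {a i, b j} * matchingSumDelete G w {b i, a j}) := by
  refine ⟨fun j => condensation w hF hab j hA hB, ?_⟩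
  rintro rfl i j hij
  have hinj := hab.injective
  have ha : a i ≠ a j := (injective_left_of_interleave hinj).ne hij
  have hb : b i ≠ b j := (injective_right_of_interleave hinj).ne hij
  have huniv : (Finset.univ : Finset (Fin 2)) = {i, j} := by
    symm
    rw [Finset.eq_univ_iff_forall]
    intro x
    simp only [Finset.mem_insert, Finset.mem_singleton]
    omega
  have hA' : A = {a i, a j} := by rw [hA, huniv]; simp
  have hB' : B = {b i, b j} := by rw [hB, huniv]; simp
  have hodd : (B.powerset.filter fun Y => Odd Y.card) = {{b i}, {b j}} := by
    ext Y
    rw [Finset.mem_filter, Finset.mem_powerset, hB', subset_pair_iff_eq]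
    simp only [Finset.mem_insert, Finset.mem_singleton]
    constructor
    · rintro ⟨rfl | rfl | rfl | rfl, h⟩ <;> simp_all [Nat.odd_iff]
    · rintro (rfl | rfl) <;> simp
  have heven : (B.powerset.filter fun Y => Even Y.card) = {∅, B} := by
    ext Y
    rw [Finset.mem_filter, Finset.mem_powerset, hB', subset_pair_iff_eq]
    simp only [Finset.mem_insert, Finset.mem_singleton]
    constructor
    · rintro ⟨rfl | rfl | rfl | rfl, h⟩ <;> simp_all
    · rintro (rfl | rfl) <;> simp [Finset.card_pair hb]
  have h := condensation w hF hab i hA hB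
  have e1 : A \ {a i} = {a j} := by
    rw [hA']; grind
  have e2 : B \ {b i} = {b j} := by
    rw [hB']; grind
  have e3 : B \ {b j} = {b i} := by
    rw [hB']; grind
  rw [hodd, heven, Finset.sum_pair (by simpa using hb),
    Finset.sum_pair (by rw [hB']; exact (Finset.insert_ne_empty _ _).symm), e1, e2, e3,
    Finset.sdiff_empty, Finset.sdiff_self, Finset.union_empty, matchingSumDelete_empty,
    hA', hB'] at h
  have u1 : ({a i, a j} ∪ {b i, b j} : Finset V) = {a i, b i, a j, b j} := by
    ext v; simp only [Finset.mem_union, Finset.mem_insert, Finset.mem_singleton]; tauto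
  rw [u1, Finset.union_comm {a j} {b i}] at h
  simp only [← Finset.insert_eq] at h
  -- The index set `W = B` produces these two factors in the opposite order.
  rw [mul_comm (matchingSumDelete G w {a i, a j})]
  exact h.symm
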